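/- Let $P$ be a left cancellative semigroup with unit element (a monoid in which $px=py$ implies $x=y$). For $X\subseteq P$ and $p\in P$ put $pX=\{px : x\in X\}$ and $p^{-1}X=\{y\in P : py\in X\}$. Let $\mathcal J$ (the constructible right ideals) be the smallest family of subsets of $P$ that contains $P$ and $\emptyset$ and is closed under $X\mapsto pX$, $X\mapsto p^{-1}X$ ($p\in P$) and finite intersections; let $\mathcal J^{(\cup)}$ be the smallest such family that is also closed under finite unions (all members of both families are right ideals). Call $\mathcal J$ independent if, whenever $X=\bigcup_{j=1}^n X_j$ with $n\ge 1$ and $X,X_1,\dots,X_n\in\mathcal J$, one has $X=X_j$ for some $j$. Let $C^*(P)$ be the universal unital C*-algebra generated by isometries $v_p$ ($p\in P$) and projections $e_X$ ($X\in\mathcal J$) subject to $$v_{pq}=v_pv_q,\quad v_pe_Xv_p^*=e_{pX},\quad e_P=1,\quad e_\emptyset=0,\quad e_{X\cap Y}=e_Xe_Y,$$ and let ${C^*}^{(\cup)}(P)$ be the universal unital C*-algebra generated by isometries $v_p$ ($p\in P$) and projections $e_X$ ($X\in\mathcal J^{(\cup)}$) subject to the same relations (for $\mathcal J^{(\cup)}$)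 and $e_{X\cup Y}=e_X+e_Y-e_{X\cap Y}$. Let $D(P)\subseteq C^*(P)$ and $D^{(\cup)}(P)\subseteq {C^*}^{(\cup)}(P)$ be the C*-subalgebras generated by $\{e_X: X\in\mathcal J\}$ and $\{e_X: X\in\mathcal J^{(\cup)}\}$, respectively. On $\ell^2(P)$ with canonical basis $(\varepsilon_x)_{x\in P}$ let $V_p$ be the isometry $V_p\varepsilon_x=\varepsilon_{px}$ and $E_X$ the orthogonal projection onto $\ell^2(X)$. Let $\lambda:C^*(P)\to\mathcal L(\ell^2(P))$ and $\lambda^{(\cup)}:{C^*}^{(\cup)}(P)\to\mathcal L(\ell^2(P))$ be the $*$-homomorphisms with $v_p\mapsto V_p$, $e_X\mapsto E_X$, and let $D_r(P)\subseteq\mathcal L(\ell^2(P))$ be the C*-subalgebra generated by $\{E_X : X\in\mathcal J\}$. Then: (a) $D^{(\cup)}(P)$ is commutative, and $\lambda^{(\cup)}$ restricts to a $*$-isomorphism from $D^{(\cup)}(P)$ onto $D_r(P)$. (b) $\mathcal J$ is independent if and only if $\lambda$ restricts to a $*$-isomorphism from $D(P)$ onto $D_r(P)$. -/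

import Mathlib

open scoped ENNReal

universe u w

namespace SemigroupCStar

noncomputable section

/-! ## Universal C*-algebras -/

/-- A family of generators together with relations that force the generators to be contractions:
`Holds A f` says that the elements `f g` of the unital C*-algebra `A` satisfy the relations. -/
structure Presentation (G : Type u) where
  Holds : ∀ (A : Type u) [CStarAlgebra A], (G → A) → Prop
  norm_le_one : ∀ (A : Type u) [CStarAlgebra A] (f : G → A), Holds A f → ∀ g, ‖f g‖ ≤ 1

/-- A realisation of the generators and relations in a (nonzero) unital C*-algebra. -/
structure Presentation.Realisation {G : Type u} (R : Presentation G) where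
  carrier : Type u
  [cstar : CStarAlgebra carrier]
  [nontriv : Nontrivial carrier]
  gen : G → carrier
  holds : R.Holds carrier gen

attribute [instance] Presentation.Realisation.cstar Presentation.Realisation.nontriv

instance inftyCStarAlgebra {I : Type*} (A : I → Type*) [∀ i, CStarAlgebra (A i)]
    [∀ i, Nontrivial (A i)] : CStarAlgebra (lp A ∞) where

namespace Presentation

variable {G : Type u} (R : Presentation G)

/-- The C*-algebra of bounded families, indexed by all realisations. -/
abbrev Ambient : Type (u + 1) := lp (fun i : R.Realisation => i.carrier) ∞

/-- The universal family: the value of the generator `g` in every realisation. -/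
def ambientGen (g : G) : R.Ambient :=
  ⟨fun i => i.gen g, memℓp_infty ⟨1, by
    rintro _ ⟨i, rfl⟩
    exact R.norm_le_one i.carrier i.gen i.holds g⟩⟩

/-- The universal C*-algebra as a C*-subalgebra of the product of all realisations: the one
generated by the universal family. -/
def universalSubalgebra : StarSubalgebra ℂ R.Ambient :=
  (StarAlgebra.adjoin ℂ (Set.range R.ambientGen)).topologicalClosure

instance : IsClosed (R.universalSubalgebra : Set R.Ambient) :=
  StarSubalgebra.isClosed_topologicalClosure _

/-- The universal C*-algebra on the given generators and relations. -/
def UniversalCStar : Type (u + 1) := R.universalSubalgebra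

instance : CStarAlgebra R.UniversalCStar :=
  inferInstanceAs (CStarAlgebra R.universalSubalgebra)

/-- The canonical generators of the universal C*-algebra. -/
def gen (g : G) : R.UniversalCStar :=
  ⟨R.ambientGen g, StarSubalgebra.le_topologicalClosure _
    (StarAlgebra.subset_adjoin ℂ _ ⟨g, rfl⟩)⟩

/-- The homomorphism from the universal C*-algebra to a given realisation: a coordinate of the
product. -/
def eval (i : R.Realisation) : R.UniversalCStar →⋆ₐ[ℂ] i.carrier where
  toFun a := (Subtype.val a : R.Ambient) i
  map_one' := rfl
  map_mul' _ _ := rfl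
  map_zero' := rfl
  map_add' _ _ := rfl
  commutes' _ := rfl
  map_star' _ := rfl

@[simp] theorem eval_gen (i : R.Realisation) (g : G) : R.eval i (R.gen g) = i.gen g := rfl

/-- The homomorphism out of the universal C*-algebra given by a family that satisfies the
relations in a nonzero C*-algebra. -/
def lift {A : Type u} [CStarAlgebra A] [Nontrivial A] (f : G → A) (hf : R.Holds A f) :
    R.UniversalCStar →⋆ₐ[ℂ] A :=
  R.eval ⟨A, f, hf⟩

@[simp] theorem lift_gen {A : Type u} [CStarAlgebra A] [Nontrivial A] (f : G → A)
    (hf : R.Holds A f) (g : G) : R.lift f hf (R.gen g) = f g := rfl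

theorem hom_ext {A : Type w} [CStarAlgebra A] {φ ψ : R.UniversalCStar →⋆ₐ[ℂ] A}
    (h : ∀ g, φ (R.gen g) = ψ (R.gen g)) : φ = ψ := by
  have := NonUnitalStarAlgHom.instContinuousLinearMapClassComplex
    (F := R.UniversalCStar →⋆ₐ[ℂ] A) (A := R.UniversalCStar) (B := A)
  have hφ : Continuous (φ : R.UniversalCStar → A) := map_continuous φ
  have hψ : Continuous (ψ : R.UniversalCStar → A) := map_continuous ψ
  refine StarAlgHom.ext_topologicalClosure hφ hψ ?_
  apply StarAlgHom.ext_adjoin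
  rintro ⟨_, _⟩ ⟨g, rfl⟩
  exact h g

end Presentation

/-! Any family in a C*-algebra of any universe lies, up to isomorphism, in a C*-algebra in the
universe of the index type; hence the choice of universe in the construction above does not
matter. -/

theorem exists_small_model {G : Type u} {A : Type w} [CStarAlgebra A] (f : G → A) :
    ∃ (B : Type u) (_ : CStarAlgebra B) (ι : B →⋆ₐ[ℂ] A) (g : G → B),
      Function.Injective ι ∧ ∀ x, ι (g x) = f x := by
  let S : StarSubalgebra ℂ A := StarAlgebra.adjoin ℂ (Set.range f)
  let T : StarSubalgebra ℂ A := S.topologicalClosure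
  have hTc : IsClosed (T : Set A) := S.isClosed_topologicalClosure
  have hS : Small.{u} S := by
    let F : FreeAlgebra ℂ (G ⊕ G) →ₐ[ℂ] A :=
      FreeAlgebra.lift ℂ (Sum.elim f (fun x => star (f x)))
    have hF : ∀ a ∈ S, ∃ y, F y = a := by
      intro a ha
      have h1 : a ∈ Algebra.adjoin ℂ (Set.range (Sum.elim f (fun x => star (f x)))) := by
        have h2 : a ∈ S.toSubalgebra := ha
        rw [StarAlgebra.adjoin_toSubalgebra] at h2
        convert h2 using 2
        rw [Set.Sum.elim_range]
        congr 1
        ext z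
        simp only [Set.mem_range, Set.mem_star]
        exact exists_congr fun x => star_eq_iff_star_eq.trans eq_comm
      rw [Algebra.adjoin_range_eq_range_freeAlgebra_lift] at h1
      exact h1
    choose y hy using hF
    refine small_of_injective (β := FreeAlgebra ℂ (G ⊕ G)) (f := fun a : S => y a a.2) ?_
    intro a b hab
    exact Subtype.ext (by rw [← hy a a.2, ← hy b b.2]; exact congrArg F hab)
  have hT : Small.{u} T := by
    have hlim : ∀ a : T, ∃ s : ℕ → S,
        Filter.Tendsto (fun n => (s n : A)) Filter.atTop (nhds (a : A)) := by
      intro a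
      have ha : (a : A) ∈ closure (S : Set A) := a.2
      obtain ⟨s, hs, hs'⟩ := mem_closure_iff_seq_limit.1 ha
      exact ⟨fun n => ⟨s n, hs n⟩, hs'⟩
    choose s hs using hlim
    refine small_of_injective (f := s) ?_
    intro a b hab
    have hb := hs b
    rw [← hab] at hb
    exact Subtype.ext (tendsto_nhds_unique (hs a) hb)
  let e : Shrink.{u} T ≃ T := (equivShrink T).symm
  let _ : NormedRing (Shrink.{u} T) := e.normedRing
  let _ : Algebra ℂ (Shrink.{u} T) := e.algebra ℂ
  let _ : StarRing (Shrink.{u} T) := e.starRing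
  have hmul : ∀ x y, e (x * y) = e x * e y := fun x y => e.apply_symm_apply _
  have hadd : ∀ x y, e (x + y) = e x + e y := fun x y => e.apply_symm_apply _
  have hsmul : ∀ (c : ℂ) x, e (c • x) = c • e x := fun c x => e.apply_symm_apply _
  have hstar : ∀ x, e (star x) = star (e x) := fun x => e.apply_symm_apply _
  have halg : ∀ c : ℂ, e (algebraMap ℂ _ c) = algebraMap ℂ _ c := fun c => e.apply_symm_apply _
  have hnorm : ∀ x, ‖x‖ = ‖e x‖ := fun x => rfl
  have hiso : Isometry e := by
    refine Isometry.of_dist_eq fun x y => ?_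
    rfl
  have hcompleteT : CompleteSpace T := hTc.completeSpace_coe
  have hcomplete : CompleteSpace (Shrink.{u} T) :=
    (IsUniformInducing.completeSpace_congr hiso.isUniformInducing e.surjective).2 hcompleteT
  let C : CStarAlgebra (Shrink.{u} T) :=
    { toNormedRing := inferInstance
      toStarRing := inferInstance
      toAlgebra := inferInstance
      norm_smul_le := fun c x => by
        rw [hnorm, hsmul, hnorm]
        exact norm_smul_le c (e x)
      star_smul := fun c x => e.injective (by rw [hstar, hsmul, hsmul, hstar, star_smul])
      norm_mul_self_le := fun x => by
        rw [hnorm, hnorm, hmul, hstar]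
        exact CStarRing.norm_mul_self_le (e x)
      complete := fun hf => hcomplete.complete hf }
  refine ⟨Shrink.{u} T, C,
    { toFun := fun x => (e x : A)
      map_one' := ?_
      map_mul' := ?_
      map_zero' := ?_
      map_add' := ?_
      commutes' := ?_
      map_star' := ?_ },
    fun x => e.symm ⟨f x, S.le_topologicalClosure (StarAlgebra.subset_adjoin ℂ _ ⟨x, rfl⟩)⟩,
    ?_, ?_⟩
  · exact congrArg Subtype.val (e.apply_symm_apply (1 : T))
  · exact fun x y => congrArg Subtype.val (hmul x y)
  · exact congrArg Subtype.val (e.apply_symm_apply (0 : T))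
  · exact fun x y => congrArg Subtype.val (hadd x y)
  · exact fun c => congrArg Subtype.val (halg c)
  · exact fun x => congrArg Subtype.val (hstar x)
  · exact fun x y h => e.injective (Subtype.ext h)
  · exact fun x => congrArg Subtype.val (e.apply_symm_apply _)

namespace Presentation

variable {G : Type u} (R : Presentation G)

/-- The universal property, for target C*-algebras in an arbitrary universe. -/
theorem existsUnique_hom {A : Type w} [CStarAlgebra A] (f : G → A)
    (hf : ∀ (B : Type u) [CStarAlgebra B] (ι : B →⋆ₐ[ℂ] A) (g : G → B),
      Function.Injective ι → (∀ x, ι (g x) = f x) → R.Holds B g) :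
    ∃! φ : R.UniversalCStar →⋆ₐ[ℂ] A, ∀ x, φ (R.gen x) = f x := by
  refine existsUnique_of_exists_of_unique ?_
    (fun φ ψ hφ hψ => R.hom_ext fun x => (hφ x).trans (hψ x).symm)
  obtain ⟨B, _, ι, g, hι, hg⟩ := exists_small_model f
  rcases subsingleton_or_nontrivial B with hB | hB
  · have h10 : (1 : A) = 0 := by
      rw [← map_one ι, ← map_zero ι, Subsingleton.elim (1 : B) 0]
    have hA : Subsingleton A := subsingleton_of_zero_eq_one h10.symm
    exact ⟨{ toFun := fun _ => 0
             map_one' := Subsingleton.elim _ _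
             map_mul' := fun _ _ => Subsingleton.elim _ _
             map_zero' := Subsingleton.elim _ _
             map_add' := fun _ _ => Subsingleton.elim _ _
             commutes' := fun _ => Subsingleton.elim _ _
             map_star' := fun _ => Subsingleton.elim _ _ }, fun _ => Subsingleton.elim _ _⟩
  · refine ⟨ι.comp (R.lift g (hf B ι g hι hg)), fun x => ?_⟩
    rw [StarAlgHom.comp_apply, lift_gen, hg]

end Presentation

/-! ## Constructible right ideals -/

section Ideals

variable (P : Type u) [Monoid P]

/-- The constructible right ideals of `P`: the smallest family that contains `P` and `∅` and is
closed under images and preimages under left multiplications and under finite intersections. -/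
inductive IsConstructible : Set P → Prop
  | univ : IsConstructible Set.univ
  | empty : IsConstructible ∅
  | image (p : P) {X : Set P} : IsConstructible X → IsConstructible ((fun x => p * x) '' X)
  | preimage (p : P) {X : Set P} : IsConstructible X → IsConstructible ((fun x => p * x) ⁻¹' X)
  | inter {X Y : Set P} : IsConstructible X → IsConstructible Y → IsConstructible (X ∩ Y)

/-- The family obtained in the same way, but closed under finite unions as well. -/
inductive IsUnionConstructible : Set P → Prop
  | univ : IsUnionConstructible Set.univ
  | empty : IsUnionConstructible ∅
  | image (p : P) {X : Set P} :
      IsUnionConstructible X → IsUnionConstructible ((fun x => p * x) '' X)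
  | preimage (p : P) {X : Set P} :
      IsUnionConstructible X → IsUnionConstructible ((fun x => p * x) ⁻¹' X)
  | inter {X Y : Set P} :
      IsUnionConstructible X → IsUnionConstructible Y → IsUnionConstructible (X ∩ Y)
  | union {X Y : Set P} :
      IsUnionConstructible X → IsUnionConstructible Y → IsUnionConstructible (X ∪ Y)

/-- The family `𝒥` of constructible right ideals. -/
def constructibleIdeals : Set (Set P) := {X | IsConstructible P X}

/-- The family `𝒥^(∪)`. -/
def unionConstructibleIdeals : Set (Set P) := {X | IsUnionConstructible P X}

variable {P}

/-- All members of `𝒥^(∪)` (hence of `𝒥`) are indeed right ideals. -/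
theorem IsUnionConstructible.mul_mem {X : Set P} (hX : IsUnionConstructible P X) :
    ∀ x ∈ X, ∀ r : P, x * r ∈ X := by
  induction hX with
  | univ => exact fun _ _ _ => trivial
  | empty => exact fun _ h _ => h.elim
  | image p _ ih =>
    rintro _ ⟨y, hy, rfl⟩ r
    exact ⟨y * r, ih y hy r, (mul_assoc p y r).symm⟩
  | preimage p _ ih =>
    intro x hx r
    have := ih _ hx r
    rwa [mul_assoc] at this
  | inter _ _ ih1 ih2 => exact fun x hx r => ⟨ih1 x hx.1 r, ih2 x hx.2 r⟩
  | union _ _ ih1 ih2 => exact fun x hx r => hx.imp (ih1 x · r) (ih2 x · r)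

theorem IsConstructible.isUnionConstructible {X : Set P} (hX : IsConstructible P X) :
    IsUnionConstructible P X := by
  induction hX with
  | univ => exact .univ
  | empty => exact .empty
  | image p _ ih => exact .image p ih
  | preimage p _ ih => exact .preimage p ih
  | inter _ _ ih1 ih2 => exact .inter ih1 ih2

variable (P) in
/-- The constructible right ideals of `P` are independent: a constructible right ideal which is a
finite union of constructible right ideals is one of them. -/
def ConstructibleIdealsIndependent : Prop :=
  ∀ (n : ℕ) (X : Set P) (Y : Fin n → Set P), 1 ≤ n → X ∈ constructibleIdeals P →
    (∀ j, Y j ∈ constructibleIdeals P) → X = ⋃ j, Y j → ∃ j, X = Y j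

end Ideals

/-! ## The relations -/

section Relations

variable {P : Type u} [Monoid P]

/-- The defining relations of `C*(P)` for isometries `v p` and projections `e X` indexed by a family `𝒥` of
subsets of `P`. For a family closed under the operations in question, as is the case below, the
auxiliary variables `Y`, `Z` just name `pX` and `X ∩ Y` as members of `𝒥`. -/
structure SatisfiesRelations (𝒥 : Set (Set P)) {A : Type w} [CStarAlgebra A]
    (v : P → A) (e : 𝒥 → A) : Prop where
  isometry : ∀ p, star (v p) * v p = 1
  projection : ∀ X, IsStarProjection (e X)
  v_mul : ∀ p q, v (p * q) = v p * v q
  conj : ∀ (p : P) (X Y : 𝒥), (Y : Set P) = (fun x => p * x) '' (X : Set P) →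
    v p * e X * star (v p) = e Y
  e_univ : ∀ X : 𝒥, (X : Set P) = Set.univ → e X = 1
  e_empty : ∀ X : 𝒥, (X : Set P) = ∅ → e X = 0
  e_inter : ∀ X Y Z : 𝒥, (Z : Set P) = (X : Set P) ∩ Y → e Z = e X * e Y

/-- The defining relations of `C*^(∪)(P)`: in addition `e (X ∪ Y) = e X + e Y - e (X ∩ Y)`. -/
structure SatisfiesUnionRelations (𝒥 : Set (Set P)) {A : Type w} [CStarAlgebra A]
    (v : P → A) (e : 𝒥 → A) : Prop extends SatisfiesRelations 𝒥 v e where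
  e_union : ∀ X Y Z W : 𝒥, (Z : Set P) = (X : Set P) ∪ Y → (W : Set P) = (X : Set P) ∩ Y →
    e Z = e X + e Y - e W

theorem SatisfiesRelations.norm_le_one {𝒥 : Set (Set P)} {A : Type w} [CStarAlgebra A]
    {f : P ⊕ 𝒥 → A} (h : SatisfiesRelations 𝒥 (fun p => f (.inl p)) (fun X => f (.inr X)))
    (g : P ⊕ 𝒥) : ‖f g‖ ≤ 1 := by
  rcases g with p | X
  · have h1 : ‖f (.inl p)‖ * ‖f (.inl p)‖ ≤ 1 := by
      rw [← CStarRing.norm_star_mul_self, h.isometry p]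
      exact IsStarProjection.norm_le (1 : A) (.one A)
    nlinarith [norm_nonneg (f (.inl p))]
  · exact IsStarProjection.norm_le _ (h.projection X)

/-- The relations pass to subalgebras. -/
theorem SatisfiesRelations.of_injective {𝒥 : Set (Set P)} {A : Type w} [CStarAlgebra A]
    {B : Type*} [CStarAlgebra B] (ι : B →⋆ₐ[ℂ] A) (hι : Function.Injective ι)
    {v : P → B} {e : 𝒥 → B}
    (h : SatisfiesRelations 𝒥 (fun p => ι (v p)) (fun X => ι (e X))) :
    SatisfiesRelations 𝒥 v e where
  isometry p := hι (by simpa [map_star] using h.isometry p)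
  projection X := by
    refine ⟨hι ?_, hι ?_⟩
    · simpa [map_star] using (h.projection X).isIdempotentElem.eq
    · simpa [map_star] using (h.projection X).isSelfAdjoint.star_eq
  v_mul p q := hι (by simpa [map_star] using h.v_mul p q)
  conj p X Y hY := hι (by simpa [map_star] using h.conj p X Y hY)
  e_univ X hX := hι (by simpa [map_star] using h.e_univ X hX)
  e_empty X hX := hι (by simpa [map_star] using h.e_empty X hX)
  e_inter X Y Z hZ := hι (by simpa [map_star] using h.e_inter X Y Z hZ)

theorem SatisfiesUnionRelations.of_injective {𝒥 : Set (Set P)} {A : Type w} [CStarAlgebra A]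
    {B : Type*} [CStarAlgebra B] (ι : B →⋆ₐ[ℂ] A) (hι : Function.Injective ι)
    {v : P → B} {e : 𝒥 → B}
    (h : SatisfiesUnionRelations 𝒥 (fun p => ι (v p)) (fun X => ι (e X))) :
    SatisfiesUnionRelations 𝒥 v e where
  toSatisfiesRelations := h.toSatisfiesRelations.of_injective ι hι
  e_union X Y Z W hZ hW := hι (by simpa [map_star] using h.e_union X Y Z W hZ hW)

end Relations

/-! ## The full semigroup C*-algebras -/

section Full

variable (P : Type u) [Monoid P]

/-- Generators and relations of `C*(P)`. -/
def fullPresentation : Presentation (P ⊕ constructibleIdeals P) where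
  Holds _ _ f := SatisfiesRelations (constructibleIdeals P)
    (fun p => f (.inl p)) (fun X => f (.inr X))
  norm_le_one _ _ _ h := h.norm_le_one

/-- Generators and relations of `C*^(∪)(P)`. -/
def unionPresentation : Presentation (P ⊕ unionConstructibleIdeals P) where
  Holds _ _ f := SatisfiesUnionRelations (unionConstructibleIdeals P)
    (fun p => f (.inl p)) (fun X => f (.inr X))
  norm_le_one _ _ _ h := h.toSatisfiesRelations.norm_le_one

/-- The full semigroup C*-algebra `C*(P)`. -/
abbrev FullCStar : Type (u + 1) := (fullPresentation P).UniversalCStar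

/-- The variant `C*^(∪)(P)` of the full semigroup C*-algebra. -/
abbrev UnionCStar : Type (u + 1) := (unionPresentation P).UniversalCStar

variable {P}

/-- The isometries `v_p` in `C*(P)`. -/
def fullV (p : P) : FullCStar P := (fullPresentation P).gen (.inl p)

/-- The projections `e_X` in `C*(P)`, for `X` in `𝒥`. -/
def fullE (X : constructibleIdeals P) : FullCStar P := (fullPresentation P).gen (.inr X)

/-- The isometries `v_p` in `C*^(∪)(P)`. -/
def unionV (p : P) : UnionCStar P := (unionPresentation P).gen (.inl p)

/-- The projections `e_X` in `C*^(∪)(P)`, for `X` in `𝒥^(∪)`. -/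
def unionE (X : unionConstructibleIdeals P) : UnionCStar P := (unionPresentation P).gen (.inr X)

theorem universal_ext {G : Type u} {R : Presentation G} {a b : R.UniversalCStar}
    (h : ∀ i, R.eval i a = R.eval i b) : a = b :=
  Subtype.ext (lp.ext (funext h))

/-- The canonical generators of `C*(P)` satisfy the relations. -/
theorem full_satisfiesRelations :
    SatisfiesRelations (constructibleIdeals P) (fullV (P := P)) fullE where
  isometry p := universal_ext fun i => i.holds.isometry p
  projection X := by
    refine ⟨universal_ext fun i => ?_, universal_ext fun i => ?_⟩
    · exact (i.holds.projection X).isIdempotentElem.eq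
    · exact (i.holds.projection X).isSelfAdjoint.star_eq
  v_mul p q := universal_ext fun i => i.holds.v_mul p q
  conj p X Y hY := universal_ext fun i => i.holds.conj p X Y hY
  e_univ X hX := universal_ext fun i => i.holds.e_univ X hX
  e_empty X hX := universal_ext fun i => i.holds.e_empty X hX
  e_inter X Y Z hZ := universal_ext fun i => i.holds.e_inter X Y Z hZ

/-- The canonical generators of `C*^(∪)(P)` satisfy the relations. -/
theorem union_satisfiesRelations :
    SatisfiesUnionRelations (unionConstructibleIdeals P) (unionV (P := P)) unionE where
  isometry p := universal_ext fun i => i.holds.isometry p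
  projection X := by
    refine ⟨universal_ext fun i => ?_, universal_ext fun i => ?_⟩
    · exact (i.holds.projection X).isIdempotentElem.eq
    · exact (i.holds.projection X).isSelfAdjoint.star_eq
  v_mul p q := universal_ext fun i => i.holds.v_mul p q
  conj p X Y hY := universal_ext fun i => i.holds.conj p X Y hY
  e_univ X hX := universal_ext fun i => i.holds.e_univ X hX
  e_empty X hX := universal_ext fun i => i.holds.e_empty X hX
  e_inter X Y Z hZ := universal_ext fun i => i.holds.e_inter X Y Z hZ
  e_union X Y Z W hZ hW := universal_ext fun i => i.holds.e_union X Y Z W hZ hW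

/-- The universal property of `C*(P)`. -/
theorem full_universal {A : Type w} [CStarAlgebra A] (v : P → A) (e : constructibleIdeals P → A)
    (h : SatisfiesRelations (constructibleIdeals P) v e) :
    ∃! φ : FullCStar P →⋆ₐ[ℂ] A, (∀ p, φ (fullV p) = v p) ∧ ∀ X, φ (fullE X) = e X := by
  have := (fullPresentation P).existsUnique_hom (Sum.elim v e) (by
    intro B _ ι g hι hg
    refine SatisfiesRelations.of_injective ι hι ?_
    simp only [hg]
    exact h)
  simp only [Sum.forall] at this
  exact this

/-- The universal property of `C*^(∪)(P)`. -/
theorem union_universal {A : Type w} [CStarAlgebra A] (v : P → A)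
    (e : unionConstructibleIdeals P → A)
    (h : SatisfiesUnionRelations (unionConstructibleIdeals P) v e) :
    ∃! φ : UnionCStar P →⋆ₐ[ℂ] A, (∀ p, φ (unionV p) = v p) ∧ ∀ X, φ (unionE X) = e X := by
  have := (unionPresentation P).existsUnique_hom (Sum.elim v e) (by
    intro B _ ι g hι hg
    refine SatisfiesUnionRelations.of_injective ι hι ?_
    simp only [hg]
    exact h)
  simp only [Sum.forall] at this
  exact this

variable (P)

/-- `D(P)`: the C*-subalgebra of `C*(P)` generated by the projections `e_X`, `X` in `𝒥`. -/
def fullD : StarSubalgebra ℂ (FullCStar P) :=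
  (StarAlgebra.adjoin ℂ (Set.range (fullE (P := P)))).topologicalClosure

/-- `D^(∪)(P)`: the C*-subalgebra of `C*^(∪)(P)` generated by the projections `e_X`,
`X` in `𝒥^(∪)`. -/
def unionD : StarSubalgebra ℂ (UnionCStar P) :=
  (StarAlgebra.adjoin ℂ (Set.range (unionE (P := P)))).topologicalClosure

end Full

/-! ## The left regular representation -/

section Regular

/-- The Hilbert space `ℓ²(P)`. -/
abbrev Ell2 (P : Type u) : Type u := lp (fun _ : P => ℂ) 2

variable {P : Type u}

/-- The canonical basis vector `ε_x` of `ℓ²(P)`. -/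
def basisVec (x : P) : Ell2 P := by
  classical exact lp.single 2 x (1 : ℂ)

theorem basisVec_apply_self (x : P) : basisVec x x = 1 := by
  classical
  simp [basisVec]

theorem basisVec_apply_ne {x y : P} (h : y ≠ x) : basisVec x y = 0 := by
  classical
  simp [basisVec, h]

instance [Nonempty P] : Nontrivial (Ell2 P) := by
  obtain ⟨x⟩ := ‹Nonempty P›
  refine ⟨basisVec x, 0, fun h => ?_⟩
  have h1 := basisVec_apply_self x
  rw [h] at h1
  exact zero_ne_one h1

/-- The orthogonal projection `E_X` of `ℓ²(P)` onto `ℓ²(X)`: multiplication by the characteristic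
function of `X`. -/
def projE (X : Set P) : Ell2 P →L[ℂ] Ell2 P :=
  LinearMap.mkContinuous
    { toFun := fun f => ⟨X.indicator f, (lp.memℓp f).mono' fun x => by
        by_cases hx : x ∈ X <;> simp [hx]⟩
      map_add' := fun f g => lp.ext (Set.indicator_add' X f g)
      map_smul' := fun c f => lp.ext (by ext x; by_cases hx : x ∈ X <;> simp [hx]) } 1
    (fun f => by
      rw [one_mul]
      refine lp.norm_mono (by norm_num) fun x => ?_
      by_cases hx : x ∈ X <;> simp [hx])

theorem projE_apply (X : Set P) (f : Ell2 P) (x : P) : projE X f x = X.indicator f x := rfl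

theorem inner_basisVec (x : P) (f : Ell2 P) : inner ℂ (basisVec x) f = f x := by
  classical
  simp [basisVec, lp.inner_single_left]

theorem projE_isStarProjection (X : Set P) : IsStarProjection (projE X) := by
  refine ⟨?_, ?_⟩
  · ext f x
    by_cases hx : x ∈ X <;> simp [projE_apply, hx]
  · refine ContinuousLinearMap.isSelfAdjoint_iff_isSymmetric.2 fun f g => ?_
    rw [lp.inner_eq_tsum, lp.inner_eq_tsum]
    refine tsum_congr fun x => ?_
    by_cases hx : x ∈ X <;> simp [projE_apply, hx]

variable [Monoid P] [IsLeftCancelMul P]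

/-- The function with value `f x` at `p x` and `0` off `pP`. -/
def shiftFun (p : P) (f : P → ℂ) : P → ℂ := Function.extend (fun x => p * x) f 0

theorem shiftFun_mul (p : P) (f : P → ℂ) (x : P) : shiftFun p f (p * x) = f x :=
  (mul_right_injective p).extend_apply f 0 x

theorem shiftFun_of_notMem (p : P) (f : P → ℂ) {y : P} (hy : ∀ x, p * x ≠ y) :
    shiftFun p f y = 0 :=
  Function.extend_apply' f (0 : P → ℂ) y fun ⟨x, hx⟩ => hy x hx

theorem support_shiftFun (p : P) (f : P → ℂ) :
    (Function.support fun y => ‖shiftFun p f y‖ ^ (2 : ℝ≥0∞).toReal) ⊆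
      Set.range (fun x => p * x) := by
  intro y hy
  by_contra h
  exact hy (by simp [shiftFun_of_notMem p f fun x hx => h ⟨x, hx⟩])

/-- The isometry `V_p` of `ℓ²(P)`, with `V_p ε_x = ε_{px}`. -/
def shiftIsometry (p : P) : Ell2 P →ₗᵢ[ℂ] Ell2 P where
  toFun f := ⟨shiftFun p f, memℓp_gen <| by
    refine ((mul_right_injective p).summable_iff ?_).1 ?_
    · intro y hy
      by_contra h
      exact hy (support_shiftFun p f h)
    · simpa [Function.comp_def, shiftFun_mul] using (lp.memℓp f).summable (by norm_num)⟩
  map_add' f g := lp.ext <| by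
    ext y
    change shiftFun p (f + g : P → ℂ) y = shiftFun p f y + shiftFun p g y
    by_cases h : ∃ x, p * x = y
    · obtain ⟨x, rfl⟩ := h
      simp [shiftFun_mul]
    · push Not at h
      simp [shiftFun_of_notMem p _ h]
  map_smul' c f := lp.ext <| by
    ext y
    by_cases h : ∃ x, p * x = y
    · obtain ⟨x, rfl⟩ := h
      simp [shiftFun_mul]
    · push Not at h
      simp [shiftFun_of_notMem p _ h]
  norm_map' f := by
    have h2 : 0 < (2 : ℝ≥0∞).toReal := by norm_num
    have key : ∑' y, ‖shiftFun p f y‖ ^ (2 : ℝ≥0∞).toReal = ∑' x, ‖f x‖ ^ (2 : ℝ≥0∞).toReal := by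
      rw [← (mul_right_injective p).tsum_eq (support_shiftFun p f)]
      simp only [shiftFun_mul]
    rw [lp.norm_eq_tsum_rpow h2, lp.norm_eq_tsum_rpow h2]
    exact congrArg (· ^ (1 / (2 : ℝ≥0∞).toReal)) key

/-- `V_p` as a bounded operator. -/
def shiftV (p : P) : Ell2 P →L[ℂ] Ell2 P := (shiftIsometry p).toContinuousLinearMap

theorem shiftV_apply (p : P) (f : Ell2 P) (y : P) : shiftV p f y = shiftFun p f y := rfl

theorem shiftV_basisVec (p x : P) : shiftV p (basisVec x) = basisVec (p * x) := by
  refine lp.ext (funext fun y => ?_)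
  rw [shiftV_apply]
  by_cases h : ∃ z, p * z = y
  · obtain ⟨z, rfl⟩ := h
    rw [shiftFun_mul]
    by_cases hz : z = x
    · rw [hz, basisVec_apply_self, basisVec_apply_self]
    · rw [basisVec_apply_ne hz, basisVec_apply_ne (fun h => hz (mul_left_cancel h))]
  · push Not at h
    rw [shiftFun_of_notMem p _ h, basisVec_apply_ne (fun hy => h x hy.symm)]

theorem shiftV_star_mul_self (p : P) : star (shiftV p) * shiftV p = 1 := by
  rw [ContinuousLinearMap.star_eq_adjoint]
  exact (ContinuousLinearMap.norm_map_iff_adjoint_comp_self (shiftV p)).1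
    (shiftIsometry p).norm_map

theorem shiftV_star_apply (p : P) (f : Ell2 P) (x : P) : (star (shiftV p) f) x = f (p * x) := by
  rw [← inner_basisVec, ContinuousLinearMap.star_eq_adjoint,
    ContinuousLinearMap.adjoint_inner_right, shiftV_basisVec, inner_basisVec]

/-- The operators `V_p` and `E_X` satisfy the relations, for every family of subsets. -/
theorem regular_satisfiesUnionRelations (𝒥 : Set (Set P)) :
    SatisfiesUnionRelations 𝒥 (shiftV (P := P)) (fun X => projE (X : Set P)) where
  isometry := shiftV_star_mul_self
  projection X := projE_isStarProjection _
  v_mul p q := by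
    ext f y
    change shiftFun (p * q) f y = shiftFun p (shiftFun q f) y
    by_cases h : ∃ x, p * x = y
    · obtain ⟨x, rfl⟩ := h
      rw [shiftFun_mul]
      by_cases h' : ∃ z, q * z = x
      · obtain ⟨z, rfl⟩ := h'
        rw [shiftFun_mul, ← mul_assoc, shiftFun_mul]
      · push Not at h'
        rw [shiftFun_of_notMem q _ h', shiftFun_of_notMem]
        exact fun z hz => h' z (mul_left_cancel ((mul_assoc p q z).symm.trans hz))
    · push Not at h
      rw [shiftFun_of_notMem p _ h, shiftFun_of_notMem]
      exact fun z hz => h (q * z) ((mul_assoc p q z).symm.trans hz)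
  conj p X Y hY := by
    ext f y
    change shiftFun p (projE (X : Set P) (star (shiftV p) f)) y = (Y : Set P).indicator f y
    by_cases h : ∃ x, p * x = y
    · obtain ⟨x, rfl⟩ := h
      have hx : p * x ∈ (Y : Set P) ↔ x ∈ (X : Set P) := by
        rw [hY]
        exact (mul_right_injective p).mem_set_image
      rw [shiftFun_mul, projE_apply]
      by_cases hxX : x ∈ (X : Set P)
      · rw [Set.indicator_of_mem hxX, Set.indicator_of_mem (hx.2 hxX), shiftV_star_apply]
      · rw [Set.indicator_of_notMem hxX, Set.indicator_of_notMem (fun h => hxX (hx.1 h))]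
    · push Not at h
      rw [shiftFun_of_notMem p _ h, Set.indicator_of_notMem]
      rw [hY]
      rintro ⟨x, -, hx⟩
      exact h x hx
  e_univ X hX := by
    ext f y
    simp [projE_apply, hX]
  e_empty X hX := by
    ext f y
    simp [projE_apply, hX]
  e_inter X Y Z hZ := by
    ext f y
    by_cases h1 : y ∈ (X : Set P) <;> by_cases h2 : y ∈ (Y : Set P) <;>
      simp [projE_apply, hZ, h1, h2]
  e_union X Y Z W hZ hW := by
    ext f y
    by_cases h1 : y ∈ (X : Set P) <;> by_cases h2 : y ∈ (Y : Set P) <;>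
      simp [projE_apply, hZ, hW, h1, h2]

variable (P)

/-- The left regular representation `λ` of `C*(P)`. -/
def regularRep : FullCStar P →⋆ₐ[ℂ] (Ell2 P →L[ℂ] Ell2 P) :=
  (fullPresentation P).lift (Sum.elim shiftV fun X => projE (X : Set P))
    (regular_satisfiesUnionRelations _).toSatisfiesRelations

/-- The left regular representation `λ^(∪)` of `C*^(∪)(P)`. -/
def unionRegularRep : UnionCStar P →⋆ₐ[ℂ] (Ell2 P →L[ℂ] Ell2 P) :=
  (unionPresentation P).lift (Sum.elim shiftV fun X => projE (X : Set P))
    (regular_satisfiesUnionRelations _)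

/-- `D_r(P)`: the C*-subalgebra of `L(ℓ²(P))` generated by the projections `E_X`, `X` in `𝒥`. -/
def reducedD : StarSubalgebra ℂ (Ell2 P →L[ℂ] Ell2 P) :=
  (StarAlgebra.adjoin ℂ (projE '' constructibleIdeals P)).topologicalClosure

variable {P}

@[simp] theorem regularRep_fullV (p : P) : regularRep P (fullV p) = shiftV p := rfl

@[simp] theorem regularRep_fullE (X : constructibleIdeals P) :
    regularRep P (fullE X) = projE (X : Set P) := rfl

@[simp] theorem unionRegularRep_unionV (p : P) : unionRegularRep P (unionV p) = shiftV p := rfl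

@[simp] theorem unionRegularRep_unionE (X : unionConstructibleIdeals P) :
    unionRegularRep P (unionE X) = projE (X : Set P) := rfl

end Regular

end

end SemigroupCStar

namespace SemigroupCStar

noncomputable section

/-! ## Restricting homomorphisms to generated C*-subalgebras -/

section Restriction

variable {A : Type u} {B : Type w} [CStarAlgebra A] [CStarAlgebra B]

/-! The projections `e X` are closed under products, so they generate a commutative C*-algebra `D`
in which their linear span is dense. A character `χ` of `D` takes only the values 0 and 1 on them,
and so defines a filter `{X | χ (e X) = 1}`. Call it prime if a member covered by finitely many sets
of the family always has one of these in the filter. For a prime filter and finitely many sets there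
is a point `x : P` lying in exactly those that belong to the filter (`exists_point_of_prime`). On a
linear combination of these `e X`, `χ` is then the diagonal matrix entry at `x` of the image
operator, whence `‖χ a‖ ≤ ‖ρ a‖`, first on the span and then on `D` by density. If `ρ a = 0`, all
characters vanish at `a`, and `a = 0` by Gelfand theory
(`SatisfiesRelations.eq_zero_of_map_eq_zero`).

Primeness is automatic for `𝒥^(∪)`, by the union relation (`SatisfiesUnionRelations.prime`); for `𝒥`
it follows from independence (`SatisfiesRelations.prime_of_independent`). Surjectivity onto `D_r`
holds because members of `𝒥^(∪)` are finite unions of members of `𝒥`.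

Conversely, let `X` be the union of sets `Y j` in `𝒥`, all different from `X`. The product of the `e
X - e (Y j)` is killed by `λ`. It is nonzero in `C*(P)`: let `P` act by translation on the Hilbert
space over the nonempty subsets of `P`, with `e X` projecting onto the subsets of `X`. These
operators satisfy the relations of `C*(P)`, and the product fixes the basis vector at `X`, which is
a subset of `X` but of no `Y j` (`independent_of_injOn`). -/

theorem starAlgHom_continuous (φ : A →⋆ₐ[ℂ] B) : Continuous φ := by
  have := NonUnitalStarAlgHom.instContinuousLinearMapClassComplex
    (F := A →⋆ₐ[ℂ] B) (A := A) (B := B)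
  exact map_continuous φ

theorem map_mem_of_mem_closure_adjoin (φ : A →⋆ₐ[ℂ] B) {s : Set A} {E : StarSubalgebra ℂ B}
    (hE : IsClosed (E : Set B)) (hs : ∀ a ∈ s, φ a ∈ E) {a : A}
    (ha : a ∈ (StarAlgebra.adjoin ℂ s).topologicalClosure) : φ a ∈ E := by
  have hle : StarAlgebra.adjoin ℂ s ≤ E.comap φ := StarAlgebra.adjoin_le hs
  have hcl : IsClosed ((E.comap φ : StarSubalgebra ℂ A) : Set A) :=
    hE.preimage (starAlgHom_continuous φ)
  exact StarSubalgebra.topologicalClosure_minimal hle hcl ha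

/-- A homomorphism that is injective on a C*-subalgebra `D` restricts to an isomorphism from `D`
onto the C*-subalgebra generated by the images of generators. -/
theorem exists_starAlgEquiv_of_injOn (φ : A →⋆ₐ[ℂ] B) {s : Set A} {t : Set B}
    (hst : ∀ a ∈ s, φ a ∈ (StarAlgebra.adjoin ℂ t).topologicalClosure)
    (hts : ∀ b ∈ t, ∃ a ∈ (StarAlgebra.adjoin ℂ s).topologicalClosure, φ a = b)
    (hinj : ∀ a ∈ (StarAlgebra.adjoin ℂ s).topologicalClosure, φ a = 0 → a = 0) :
    ∃ Φ : (StarAlgebra.adjoin ℂ s).topologicalClosure ≃⋆ₐ[ℂ]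
        (StarAlgebra.adjoin ℂ t).topologicalClosure,
      ∀ d, (Φ d : B) = φ d := by
  set D := (StarAlgebra.adjoin ℂ s).topologicalClosure with hD
  set E := (StarAlgebra.adjoin ℂ t).topologicalClosure with hE
  have hDc : IsClosed (D : Set A) := StarSubalgebra.isClosed_topologicalClosure _
  have hEc : IsClosed (E : Set B) := StarSubalgebra.isClosed_topologicalClosure _
  let ψ : D →⋆ₐ[ℂ] B := φ.comp D.subtype
  have hψ : Function.Injective ψ :=
    (injective_iff_map_eq_zero ψ).2 fun d hd => Subtype.ext (hinj d d.2 hd)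
  -- An injective *-homomorphism of C*-algebras is isometric, so its range is complete. Hence it
  -- suffices to hit the generators of `E`.
  have hrange : IsClosed ((ψ.range : StarSubalgebra ℂ B) : Set B) := by
    have : CompleteSpace D := hDc.completeSpace_coe
    exact (NonUnitalStarAlgHom.isometry ψ hψ).isClosedEmbedding.isClosed_range
  have hEle : E ≤ ψ.range := by
    refine StarSubalgebra.topologicalClosure_minimal (StarAlgebra.adjoin_le ?_) hrange
    intro b hb
    obtain ⟨a, ha, rfl⟩ := hts b hb
    exact ⟨⟨a, ha⟩, rfl⟩
  have hmem : ∀ d, ψ d ∈ E := fun d => map_mem_of_mem_closure_adjoin φ hEc hst d.2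
  refine ⟨StarAlgEquiv.ofBijective (ψ.codRestrict E hmem) ⟨?_, ?_⟩, fun d => rfl⟩
  · exact fun x y h => hψ (congrArg Subtype.val h)
  · rintro ⟨b, hb⟩
    obtain ⟨d, hd⟩ := hEle hb
    exact ⟨d, Subtype.ext hd⟩

/-- The C*-algebra generated by commuting selfadjoint elements is commutative. -/
theorem mul_comm_of_mem_closure_adjoin {s : Set A} (hstar : ∀ a ∈ s, star a = a)
    (hcomm : ∀ a ∈ s, ∀ b ∈ s, a * b = b * a) :
    ∀ a ∈ (StarAlgebra.adjoin ℂ s).topologicalClosure,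
      ∀ b ∈ (StarAlgebra.adjoin ℂ s).topologicalClosure, a * b = b * a := by
  have hc := StarAlgebra.isMulCommutative_adjoin ℂ hcomm
    fun a ha b hb => by rw [hstar b hb]; exact hcomm a ha b hb
  intro a ha b hb
  exact congrArg Subtype.val (((StarAlgebra.adjoin ℂ s).commRingTopologicalClosure
    fun x y => hc.is_comm.comm x y).mul_comm ⟨a, ha⟩ ⟨b, hb⟩)

/-- An element of a commutative C*-subalgebra on which all characters vanish is zero. -/
theorem eq_zero_of_characters {D : StarSubalgebra ℂ A} (hD : IsClosed (D : Set A))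
    (hcomm : ∀ a ∈ D, ∀ b ∈ D, a * b = b * a) {a : D}
    (h : ∀ χ : D →ₐ[ℂ] ℂ, Continuous χ → χ a = 0) : a = 0 := by
  let _ : CommCStarAlgebra D :=
    { (inferInstance : CStarAlgebra D) with
      mul_comm := fun x y => Subtype.ext (hcomm x x.2 y y.2) }
  refine (gelfandTransform_isometry D).injective ?_
  rw [map_zero]
  ext χ
  exact h (WeakDual.CharacterSpace.toAlgHom χ) (map_continuous χ)

end Restriction

/-! ## Characters and point evaluations -/

section Characters

variable {P : Type u}

/-- On finitely many sets, a prime filter in a family closed under intersections is given by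
a point. -/
theorem exists_point_of_prime {𝒥 : Set (Set P)} (huniv : Set.univ ∈ 𝒥)
    (hinter : ∀ X ∈ 𝒥, ∀ Y ∈ 𝒥, X ∩ Y ∈ 𝒥) (T : 𝒥 → Prop) (hT : T ⟨Set.univ, huniv⟩)
    (hTinter : ∀ X Y : 𝒥, T X → T Y → T ⟨X ∩ Y, hinter X X.2 Y Y.2⟩)
    (hprime : ∀ (X : 𝒥) (s : Finset 𝒥), (X : Set P) ⊆ ⋃ Y ∈ s, (Y : Set P) → T X → ∃ Y ∈ s, T Y)
    (s : Finset 𝒥) : ∃ x : P, ∀ X ∈ s, x ∈ (X : Set P) ↔ T X := by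
  classical
  have hlower : ∀ r : Finset 𝒥, (∀ X ∈ r, T X) →
      ∃ Z : 𝒥, T Z ∧ ∀ X ∈ r, (Z : Set P) ⊆ X := by
    intro r
    induction r using Finset.induction_on with
    | empty => exact fun _ => ⟨_, hT, by simp⟩
    | insert a r _ ih =>
      intro h
      obtain ⟨Z, hZ, hZr⟩ := ih fun X hX => h X (Finset.mem_insert_of_mem hX)
      refine ⟨_, hTinter a Z (h a (Finset.mem_insert_self a r)) hZ, fun X hX => ?_⟩
      rcases Finset.mem_insert.1 hX with rfl | hX
      · exact Set.inter_subset_left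
      · exact Set.inter_subset_right.trans (hZr X hX)
  obtain ⟨Z, hZ, hZs⟩ := hlower (s.filter T) fun X hX => (Finset.mem_filter.1 hX).2
  -- `Z` lies in the filter and inside every set of `s` that does. If no point fits, each point of
  -- `Z` violates the condition at a set of `s` outside the filter. These sets then cover `Z`,
  -- against primeness.
  by_contra! hno
  obtain ⟨Y, hY, hTY⟩ := hprime Z (s.filter fun X => ¬ T X) (fun x hx => by
    obtain ⟨X, hX, hxX⟩ := hno x
    have hTX : ¬ T X := fun h => by
      have := hZs X (Finset.mem_filter.2 ⟨hX, h⟩) hx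
      tauto
    refine Set.mem_iUnion₂.2 ⟨X, Finset.mem_filter.2 ⟨hX, hTX⟩, ?_⟩
    tauto) hZ
  exact (Finset.mem_filter.1 hY).2 hTY

/-- The elements of the *-algebra generated by projections closed under products are linear
combinations of them. -/
theorem adjoin_subset_span {A : Type w} [CStarAlgebra A] {s : Set A} (hone : 1 ∈ s)
    (hstar : ∀ a ∈ s, star a = a) (hmul : ∀ a ∈ s, ∀ b ∈ s, a * b ∈ s) {a : A}
    (ha : a ∈ StarAlgebra.adjoin ℂ s) : a ∈ Submodule.span ℂ s := by
  induction ha using StarAlgebra.adjoin_induction with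
  | mem x hx => exact Submodule.subset_span hx
  | algebraMap r =>
    rw [Algebra.algebraMap_eq_smul_one]
    exact Submodule.smul_mem _ r (Submodule.subset_span hone)
  | add x y _ _ hx hy => exact add_mem hx hy
  | mul x y _ _ hx hy =>
    have := Submodule.mul_mem_mul hx hy
    rw [Submodule.span_mul_span] at this
    refine Submodule.span_mono ?_ this
    rintro _ ⟨a, ha, b, hb, rfl⟩
    exact hmul a ha b hb
  | star x hx' hx =>
    clear hx'
    induction hx using Submodule.span_induction with
    | mem x hx => rw [hstar x hx]; exact Submodule.subset_span hx
    | zero => simp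
    | add x y _ _ hx hy => rw [star_add]; exact add_mem hx hy
    | smul c x _ hx => rw [star_smul]; exact Submodule.smul_mem _ _ hx

theorem projE_union (X Y : Set P) :
    projE (X ∪ Y) = projE X + projE Y - projE X * projE Y := by
  ext f x
  by_cases h1 : x ∈ X <;> by_cases h2 : x ∈ Y <;> simp [projE_apply, h1, h2]

/-- Diagonal entries serve as point evaluations on combinations of the `projE X`; this bounds a
character by the norm of the represented operator. -/
theorem norm_diagonal_le (T : Ell2 P →L[ℂ] Ell2 P) (x : P) : ‖T (basisVec x) x‖ ≤ ‖T‖ := by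
  classical
  have h1 : ‖basisVec x‖ = 1 := by simp [basisVec, lp.norm_single]
  calc ‖T (basisVec x) x‖ ≤ ‖T (basisVec x)‖ := lp.norm_apply_le_norm (by norm_num) _ x
    _ ≤ ‖T‖ * ‖basisVec x‖ := T.le_opNorm _
    _ = ‖T‖ := by rw [h1, mul_one]

variable [Monoid P]

/-- Both products of two generators are the projection of the same intersection. -/
theorem SatisfiesRelations.commute {𝒥 : Set (Set P)} (hinter : ∀ X ∈ 𝒥, ∀ Y ∈ 𝒥, X ∩ Y ∈ 𝒥)
    {A : Type w} [CStarAlgebra A] {v : P → A} {e : 𝒥 → A} (h : SatisfiesRelations 𝒥 v e) :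
    ∀ a ∈ (StarAlgebra.adjoin ℂ (Set.range e)).topologicalClosure,
      ∀ b ∈ (StarAlgebra.adjoin ℂ (Set.range e)).topologicalClosure, a * b = b * a := by
  apply mul_comm_of_mem_closure_adjoin
  · rintro _ ⟨X, rfl⟩
    exact (h.projection X).isSelfAdjoint.star_eq
  · rintro _ ⟨X, rfl⟩ _ ⟨Y, rfl⟩
    rw [← h.e_inter X Y ⟨X ∩ Y, hinter X X.2 Y Y.2⟩ rfl,
      ← h.e_inter Y X ⟨X ∩ Y, hinter X X.2 Y Y.2⟩ (Set.inter_comm _ _)]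

/-- A homomorphism with `e X ↦ E_X` is injective on the C*-algebra generated by the projections
`e X`, provided that the filter of sets defined by a character is prime with respect to finite
covers. -/
theorem SatisfiesRelations.eq_zero_of_map_eq_zero {𝒥 : Set (Set P)} (huniv : Set.univ ∈ 𝒥)
    (hinter : ∀ X ∈ 𝒥, ∀ Y ∈ 𝒥, X ∩ Y ∈ 𝒥)
    {A : Type w} [CStarAlgebra A] {v : P → A} {e : 𝒥 → A} (h : SatisfiesRelations 𝒥 v e)
    {D : StarSubalgebra ℂ A}
    (hD : D = (StarAlgebra.adjoin ℂ (Set.range e)).topologicalClosure)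
    (hprime : ∀ (χ : D →ₐ[ℂ] ℂ) (e' : 𝒥 → D), (∀ X, (e' X : A) = e X) →
      ∀ (X : 𝒥) (s : Finset 𝒥), (X : Set P) ⊆ ⋃ Y ∈ s, (Y : Set P) → χ (e' X) = 1 →
        ∃ Y ∈ s, χ (e' Y) = 1)
    (ρ : A →⋆ₐ[ℂ] (Ell2 P →L[ℂ] Ell2 P)) (hρ : ∀ X : 𝒥, ρ (e X) = projE (X : Set P)) :
    ∀ a ∈ D, ρ a = 0 → a = 0 := by
  intro a ha hρa
  have hDc : IsClosed (D : Set A) := hD ▸ StarSubalgebra.isClosed_topologicalClosure _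
  have hle : StarAlgebra.adjoin ℂ (Set.range e) ≤ D :=
    hD ▸ StarSubalgebra.le_topologicalClosure _
  have hmem : ∀ X, e X ∈ D := fun X => hle (StarAlgebra.subset_adjoin ℂ _ ⟨X, rfl⟩)
  let e' : 𝒥 → D := fun X => ⟨e X, hmem X⟩
  suffices (⟨a, ha⟩ : D) = 0 from congrArg Subtype.val this
  refine eq_zero_of_characters hDc (hD ▸ h.commute hinter) fun χ hχ => ?_
  have hinter' : ∀ X Y Z : 𝒥, (Z : Set P) = (X : Set P) ∩ Y → e' Z = e' X * e' Y :=
    fun X Y Z hZ => Subtype.ext (h.e_inter X Y Z hZ)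
  have h01 : ∀ X, χ (e' X) = 0 ∨ χ (e' X) = 1 := fun X => by
    have : χ (e' X) * χ (e' X) = χ (e' X) := by
      rw [← map_mul, ← hinter' X X X (Set.inter_self _).symm]
    rcases eq_or_ne (χ (e' X)) 0 with h0 | h0
    · exact .inl h0
    · exact .inr (mul_left_cancel₀ h0 (this.trans (mul_one _).symm))
  -- On the dense *-subalgebra only finitely many sets occur, so the filter of `χ` can be replaced
  -- by a point; that point depends on `b`, the resulting bound does not.
  have hspan : ∀ b (hb : b ∈ StarAlgebra.adjoin ℂ (Set.range e)),
      ‖χ ⟨b, hle hb⟩‖ ≤ ‖ρ b‖ := by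
    intro b hb
    have hb' : b ∈ Submodule.span ℂ (Set.range e) := by
      refine adjoin_subset_span (s := Set.range e) ⟨⟨_, huniv⟩, h.e_univ _ rfl⟩ ?_ ?_ hb
      · rintro _ ⟨X, rfl⟩
        exact (h.projection X).isSelfAdjoint.star_eq
      · rintro _ ⟨X, rfl⟩ _ ⟨Y, rfl⟩
        exact ⟨⟨X ∩ Y, hinter X X.2 Y Y.2⟩, h.e_inter X Y ⟨_, hinter X X.2 Y Y.2⟩ rfl⟩
    obtain ⟨c, rfl⟩ := Finsupp.mem_span_range_iff_exists_finsupp.1 hb'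
    obtain ⟨x, hx⟩ := exists_point_of_prime huniv hinter (fun X => χ (e' X) = 1)
      (by
        have : e' ⟨_, huniv⟩ = 1 := Subtype.ext (h.e_univ _ rfl)
        rw [this, map_one])
      (fun X Y hX hY => by rw [hinter' X Y _ rfl, map_mul, hX, hY, mul_one])
      (hprime χ e' fun _ => rfl) c.support
    have hval : χ ⟨_, hle hb⟩ = ρ (c.sum fun X r => r • e X) (basisVec x) x := by
      have h1 : (⟨_, hle hb⟩ : D) = ∑ X ∈ c.support, c X • e' X :=
        Subtype.ext (by simp [Finsupp.sum, e'])
      have h2 : ρ (c.sum fun X r => r • e X) = ∑ X ∈ c.support, c X • projE (X : Set P) := by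
        simp [Finsupp.sum, hρ]
      rw [h1, h2, map_sum]
      simp only [_root_.sum_apply, lp.coeFn_sum, Finset.sum_apply]
      refine Finset.sum_congr rfl fun X hX => ?_
      rw [map_smul]
      change c X • χ (e' X) = c X • (X : Set P).indicator (basisVec x) x
      by_cases hxX : x ∈ (X : Set P)
      · rw [Set.indicator_of_mem hxX, basisVec_apply_self, (hx X hX).1 hxX]
      · rw [Set.indicator_of_notMem hxX, (h01 X).resolve_right fun h => hxX ((hx X hX).2 h)]
    rw [hval]
    exact norm_diagonal_le _ x
  -- The bound is a closed condition and passes to the limit `a`, where its right-hand side is 0.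
  have hclosed : IsClosed {d : D | ‖χ d‖ ≤ ‖ρ d‖} :=
    isClosed_le hχ.norm ((starAlgHom_continuous ρ).comp continuous_subtype_val).norm
  have hacl : a ∈ closure (StarAlgebra.adjoin ℂ (Set.range e) : Set A) := by
    rw [hD] at ha
    exact ha
  obtain ⟨b, hb, hba⟩ := mem_closure_iff_seq_limit.1 hacl
  have hlim : Filter.Tendsto (fun n => (⟨b n, hle (hb n)⟩ : D)) Filter.atTop (nhds ⟨a, ha⟩) :=
    tendsto_subtype_rng.2 hba
  have := hclosed.mem_of_tendsto hlim (.of_forall fun n => hspan _ (hb n))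
  rw [Set.mem_ofPred_eq, hρa, norm_zero] at this
  exact norm_le_zero_iff.1 this

end Characters

/-! ## The families `𝒥` and `𝒥^(∪)` -/

section Families

variable {P : Type u} [Monoid P]

/-- Images, preimages and intersections distribute over unions, so the finite unions of
constructible ideals already form a family with all the closure properties. -/
theorem IsUnionConstructible.exists_finset {X : Set P} (hX : IsUnionConstructible P X) :
    ∃ s : Set (Set P), s.Finite ∧ (∀ Y ∈ s, IsConstructible P Y) ∧ X = ⋃₀ s := by
  induction hX with
  | univ => exact ⟨{Set.univ}, Set.finite_singleton _, by simp [IsConstructible.univ], by simp⟩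
  | empty => exact ⟨∅, Set.finite_empty, by simp, by simp⟩
  | image p _ ih =>
    obtain ⟨s, hs, h, rfl⟩ := ih
    refine ⟨_, hs.image fun Y => (fun x => p * x) '' Y, ?_, ?_⟩
    · rintro _ ⟨Y, hY, rfl⟩
      exact .image p (h Y hY)
    · rw [Set.image_sUnion]
  | preimage p _ ih =>
    obtain ⟨s, hs, h, rfl⟩ := ih
    refine ⟨_, hs.image fun Y => (fun x => p * x) ⁻¹' Y, ?_, ?_⟩
    · rintro _ ⟨Y, hY, rfl⟩
      exact .preimage p (h Y hY)
    · rw [Set.preimage_sUnion, Set.sUnion_image]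
  | inter _ _ ih1 ih2 =>
    obtain ⟨s, hs, h, rfl⟩ := ih1
    obtain ⟨t, ht, h', rfl⟩ := ih2
    refine ⟨_, hs.image2 (· ∩ ·) ht, ?_, ?_⟩
    · rintro _ ⟨Y, hY, Z, hZ, rfl⟩
      exact .inter (h Y hY) (h' Z hZ)
    · ext x
      simp only [Set.mem_inter_iff, Set.mem_sUnion, Set.mem_image2]
      constructor
      · rintro ⟨⟨Y, hY, hxY⟩, Z, hZ, hxZ⟩
        exact ⟨_, ⟨Y, hY, Z, hZ, rfl⟩, hxY, hxZ⟩
      · rintro ⟨_, ⟨Y, hY, Z, hZ, rfl⟩, hxY, hxZ⟩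
        exact ⟨⟨Y, hY, hxY⟩, Z, hZ, hxZ⟩
  | union _ _ ih1 ih2 =>
    obtain ⟨s, hs, h, rfl⟩ := ih1
    obtain ⟨t, ht, h', rfl⟩ := ih2
    exact ⟨s ∪ t, hs.union ht, fun Y hY => hY.elim (h Y) (h' Y), (Set.sUnion_union s t).symm⟩

theorem projE_mem_reducedD {X : Set P} (hX : IsConstructible P X) [IsLeftCancelMul P] :
    projE X ∈ reducedD P :=
  StarSubalgebra.le_topologicalClosure _ (StarAlgebra.subset_adjoin ℂ _ ⟨X, hX, rfl⟩)

/-- By inclusion–exclusion, the projection of a finite union is a polynomial in the projections of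
its pieces. So the larger family generates nothing beyond `D_r`. -/
theorem projE_mem_reducedD_of_union [IsLeftCancelMul P] {X : Set P}
    (hX : IsUnionConstructible P X) : projE X ∈ reducedD P := by
  obtain ⟨s, hs, h, rfl⟩ := hX.exists_finset
  clear hX
  induction s, hs using Set.Finite.induction_on with
  | empty => rw [Set.sUnion_empty]; exact projE_mem_reducedD .empty
  | @insert Y s _ _ ih =>
    rw [Set.sUnion_insert, projE_union]
    have h1 := projE_mem_reducedD (h Y (Set.mem_insert Y s))
    have h2 := ih fun Z hZ => h Z (Set.mem_insert_of_mem Y hZ)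
    exact sub_mem (add_mem h1 h2) (mul_mem h1 h2)

end Families

/-! ## Primeness of the filters defined by characters -/

section Prime

variable {P : Type u} [Monoid P]

/-- If the sets `Y` cover `X`, then `X` is the union of the constructible sets `X ∩ Y`. Independence
makes one of these equal to `X`, and `e X = e X * e Y` forces `χ` to be 1 at `Y`. -/
theorem SatisfiesRelations.prime_of_independent (hind : ConstructibleIdealsIndependent P)
    {A : Type w} [CStarAlgebra A] {v : P → A} {e : constructibleIdeals P → A}
    (h : SatisfiesRelations (constructibleIdeals P) v e) {D : StarSubalgebra ℂ A}
    (χ : D →ₐ[ℂ] ℂ) (e' : constructibleIdeals P → D) (he' : ∀ X, (e' X : A) = e X)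
    (X : constructibleIdeals P) (s : Finset (constructibleIdeals P))
    (hXs : (X : Set P) ⊆ ⋃ Y ∈ s, (Y : Set P)) (hX : χ (e' X) = 1) :
    ∃ Y ∈ s, χ (e' Y) = 1 := by
  -- Independence speaks only of unions with at least one member; an empty cover means `X = ∅`,
  -- where `e X = 0`.
  rcases s.eq_empty_or_nonempty with rfl | hs
  · have h0 : e' X = 0 := Subtype.ext <| (he' X).trans <| h.e_empty X <|
      Set.subset_eq_empty hXs (by simp)
    rw [h0, map_zero] at hX
    exact absurd hX zero_ne_one
  · obtain ⟨j, hj⟩ := hind s.card X (fun j => (X : Set P) ∩ (s.equivFin.symm j : Set P))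
      hs.card_pos X.2 (fun j => .inter X.2 (s.equivFin.symm j).1.2) (by
        refine Set.Subset.antisymm (fun x hx => ?_)
          (Set.iUnion_subset fun j => Set.inter_subset_left)
        obtain ⟨Y, hY, hxY⟩ := Set.mem_iUnion₂.1 (hXs hx)
        exact Set.mem_iUnion.2 ⟨s.equivFin ⟨Y, hY⟩, hx, by simpa using hxY⟩)
    refine ⟨(s.equivFin.symm j).1, (s.equivFin.symm j).2, ?_⟩
    have h1 : e' X = e' X * e' (s.equivFin.symm j).1 := Subtype.ext <| by
      simpa only [he', MulMemClass.coe_mul] using h.e_inter X (s.equivFin.symm j).1 X hj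
    have h2 : χ (e' X) = χ (e' X) * χ (e' (s.equivFin.symm j).1) := by
      rw [← map_mul, ← h1]
    rw [hX, one_mul] at h2
    exact h2.symm

/-- If `χ` vanished at every set of the cover, the union relation would make it vanish at their
union `U`, contradicting `e X = e X * e U`. -/
theorem SatisfiesUnionRelations.prime {A : Type w} [CStarAlgebra A] {v : P → A}
    {e : unionConstructibleIdeals P → A}
    (h : SatisfiesUnionRelations (unionConstructibleIdeals P) v e) {D : StarSubalgebra ℂ A}
    (χ : D →ₐ[ℂ] ℂ) (e' : unionConstructibleIdeals P → D) (he' : ∀ X, (e' X : A) = e X)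
    (X : unionConstructibleIdeals P) (s : Finset (unionConstructibleIdeals P))
    (hXs : (X : Set P) ⊆ ⋃ Y ∈ s, (Y : Set P)) (hX : χ (e' X) = 1) :
    ∃ Y ∈ s, χ (e' Y) = 1 := by
  classical
  have hinter : ∀ X Y Z : unionConstructibleIdeals P, (Z : Set P) = (X : Set P) ∩ Y →
      χ (e' Z) = χ (e' X) * χ (e' Y) := fun X Y Z hZ => by
    rw [← map_mul]
    exact congrArg χ (Subtype.ext (by simpa [he'] using h.e_inter X Y Z hZ))
  have hunion : ∀ X Y Z W : unionConstructibleIdeals P, (Z : Set P) = (X : Set P) ∪ Y →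
      (W : Set P) = (X : Set P) ∩ Y → χ (e' Z) = χ (e' X) + χ (e' Y) - χ (e' W) :=
    fun X Y Z W hZ hW => by
      rw [← map_add, ← map_sub]
      exact congrArg χ (Subtype.ext (by simpa [he'] using h.e_union X Y Z W hZ hW))
  have h01 : ∀ X, χ (e' X) = 0 ∨ χ (e' X) = 1 := fun X => by
    rcases eq_or_ne (χ (e' X)) 0 with h0 | h0
    · exact .inl h0
    · exact .inr (mul_left_cancel₀ h0
        ((hinter X X X (Set.inter_self _).symm).symm.trans (mul_one _).symm))
  by_contra! hno
  obtain ⟨U, hU, hU0⟩ : ∃ U : unionConstructibleIdeals P,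
      (U : Set P) = ⋃ Y ∈ s, (Y : Set P) ∧ χ (e' U) = 0 := by
    -- The union is built one set at a time, and the smaller subfamilies need not cover `X`.
    clear hXs
    induction s using Finset.induction_on with
    | empty =>
      refine ⟨⟨∅, .empty⟩, by simp, ?_⟩
      have h0 : e' ⟨∅, .empty⟩ = 0 := Subtype.ext ((he' _).trans (h.e_empty _ rfl))
      rw [h0, map_zero]
    | insert Y s _ ih =>
      obtain ⟨U, hU, hU0⟩ := ih fun Z hZ => hno Z (Finset.mem_insert_of_mem hZ)
      refine ⟨⟨Y ∪ U, .union Y.2 U.2⟩, by simp [hU], ?_⟩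
      have hY0 := (h01 Y).resolve_right (hno Y (Finset.mem_insert_self Y s))
      rw [hunion Y U _ ⟨Y ∩ U, .inter Y.2 U.2⟩ rfl rfl, hinter Y U ⟨Y ∩ U, .inter Y.2 U.2⟩ rfl,
        hY0, hU0]
      simp
  have := hinter X U X (Set.inter_eq_left.2 (hU ▸ hXs)).symm
  rw [hX, hU0, mul_zero] at this
  exact one_ne_zero this

end Prime

/-! ## The representation on the nonempty subsets -/

section SubsetRep

variable {Q : Type u}

/-! ### Isometries of `ℓ²(Q)` induced by injective self-maps, and diagonal products. -/

theorem support_extend (σ : Q → Q) (f : Q → ℂ) :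
    (Function.support fun y => ‖Function.extend σ f 0 y‖ ^ (2 : ℝ≥0∞).toReal) ⊆ Set.range σ := by
  intro y hy
  by_contra h
  exact hy (by simp [Function.extend_apply' f (0 : Q → ℂ) y h])

/-- The isometry of `ℓ²(Q)` given by an injective map `σ`, with `ε_x ↦ ε_{σ x}`. -/
def extendIsometry {σ : Q → Q} (hσ : σ.Injective) : Ell2 Q →ₗᵢ[ℂ] Ell2 Q where
  toFun f := ⟨Function.extend σ f 0, memℓp_gen <| by
    refine (hσ.summable_iff ?_).1 ?_
    · intro y hy
      by_contra h
      exact hy (support_extend σ f h)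
    · simpa [Function.comp_def, hσ.extend_apply] using (lp.memℓp f).summable (by norm_num)⟩
  map_add' f g := lp.ext <| by
    ext y
    change Function.extend σ (f + g : Q → ℂ) 0 y
      = Function.extend σ f 0 y + Function.extend σ g 0 y
    by_cases h : ∃ x, σ x = y
    · obtain ⟨x, rfl⟩ := h
      simp [hσ.extend_apply]
    · simp [Function.extend_apply' _ _ _ h]
  map_smul' c f := lp.ext <| by
    ext y
    by_cases h : ∃ x, σ x = y
    · obtain ⟨x, rfl⟩ := h
      simp [hσ.extend_apply]
    · simp [Function.extend_apply' _ _ _ h]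
  norm_map' f := by
    have h2 : 0 < (2 : ℝ≥0∞).toReal := by norm_num
    have key : ∑' y, ‖Function.extend σ f 0 y‖ ^ (2 : ℝ≥0∞).toReal
        = ∑' x, ‖f x‖ ^ (2 : ℝ≥0∞).toReal := by
      rw [← hσ.tsum_eq (support_extend σ f)]
      simp only [hσ.extend_apply]
    rw [lp.norm_eq_tsum_rpow h2, lp.norm_eq_tsum_rpow h2]
    exact congrArg (· ^ (1 / (2 : ℝ≥0∞).toReal)) key

/-- `extendIsometry` as a bounded operator. -/
def extendV {σ : Q → Q} (hσ : σ.Injective) : Ell2 Q →L[ℂ] Ell2 Q :=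
  (extendIsometry hσ).toContinuousLinearMap

theorem extendV_apply_map {σ : Q → Q} (hσ : σ.Injective) (f : Ell2 Q) (x : Q) :
    extendV hσ f (σ x) = f x := hσ.extend_apply f 0 x

theorem extendV_apply_of_notMem {σ : Q → Q} (hσ : σ.Injective) (f : Ell2 Q) {y : Q}
    (hy : ¬ ∃ x, σ x = y) : extendV hσ f y = 0 := Function.extend_apply' f (0 : Q → ℂ) y hy

theorem extendV_basisVec {σ : Q → Q} (hσ : σ.Injective) (x : Q) :
    extendV hσ (basisVec x) = basisVec (σ x) := by
  refine lp.ext (funext fun y => ?_)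
  by_cases h : ∃ z, σ z = y
  · obtain ⟨z, rfl⟩ := h
    rw [extendV_apply_map]
    by_cases hz : z = x
    · rw [hz, basisVec_apply_self, basisVec_apply_self]
    · rw [basisVec_apply_ne hz, basisVec_apply_ne fun h => hz (hσ h)]
  · rw [extendV_apply_of_notMem hσ _ h, basisVec_apply_ne fun hy => h ⟨x, hy.symm⟩]

theorem extendV_star_mul_self {σ : Q → Q} (hσ : σ.Injective) :
    star (extendV hσ) * extendV hσ = 1 := by
  rw [ContinuousLinearMap.star_eq_adjoint]
  exact (ContinuousLinearMap.norm_map_iff_adjoint_comp_self (extendV hσ)).1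
    (extendIsometry hσ).norm_map

theorem extendV_star_apply {σ : Q → Q} (hσ : σ.Injective) (f : Ell2 Q) (x : Q) :
    (star (extendV hσ) f) x = f (σ x) := by
  rw [← inner_basisVec, ContinuousLinearMap.star_eq_adjoint,
    ContinuousLinearMap.adjoint_inner_right, extendV_basisVec, inner_basisVec]

/-- The composite is a separate map `υ`, so that `translate (p * q)` fits with its own proof of
injectivity. -/
theorem extendV_comp {σ τ υ : Q → Q} (hσ : σ.Injective) (hτ : τ.Injective) (hυ : υ.Injective)
    (h : ∀ x, υ x = σ (τ x)) : extendV hυ = extendV hσ * extendV hτ := by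
  ext f y
  change _ = extendV hσ (extendV hτ f) y
  by_cases h1 : ∃ x, σ x = y
  · obtain ⟨x, rfl⟩ := h1
    rw [extendV_apply_map]
    by_cases h2 : ∃ z, τ z = x
    · obtain ⟨z, rfl⟩ := h2
      rw [extendV_apply_map, ← h, extendV_apply_map]
    · rw [extendV_apply_of_notMem hτ _ h2, extendV_apply_of_notMem]
      rintro ⟨z, hz⟩
      exact h2 ⟨z, hσ ((h z).symm.trans hz)⟩
  · rw [extendV_apply_of_notMem hσ _ h1, extendV_apply_of_notMem]
    rintro ⟨z, hz⟩
    exact h1 ⟨τ z, (h z).symm.trans hz⟩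

theorem extendV_conj_projE {σ : Q → Q} (hσ : σ.Injective) (X : Set Q) :
    extendV hσ * projE X * star (extendV hσ) = projE (σ '' X) := by
  ext f y
  change extendV hσ (projE X (star (extendV hσ) f)) y = (σ '' X).indicator f y
  by_cases h : ∃ x, σ x = y
  · obtain ⟨x, rfl⟩ := h
    rw [extendV_apply_map, projE_apply]
    by_cases hx : x ∈ X
    · rw [Set.indicator_of_mem hx, Set.indicator_of_mem (Set.mem_image_of_mem σ hx),
        extendV_star_apply]
    · rw [Set.indicator_of_notMem hx,
        Set.indicator_of_notMem fun h => hx (hσ.mem_set_image.1 h)]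
  · rw [extendV_apply_of_notMem hσ _ h, Set.indicator_of_notMem]
    rintro ⟨x, -, hx⟩
    exact h ⟨x, hx⟩

/-- All factors are diagonal, so the product is computed pointwise. It is needed over `P`, where the
product vanishes, and over the nonempty subsets of `P`, where it does not. -/
theorem list_prod_projE_sub_apply (X : Set Q) (L : List (Set Q)) (f : Ell2 Q) (x : Q) :
    (L.map fun Y => projE X - projE Y).prod f x =
      (L.map fun Y => X.indicator 1 x - Y.indicator (1 : Q → ℂ) x).prod * f x := by
  induction L with
  | nil => simp
  | cons Y L ih =>
    have h : ∀ g : Ell2 Q, (projE X - projE Y) g x =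
        (X.indicator 1 x - Y.indicator (1 : Q → ℂ) x) * g x := fun g => by
      by_cases h1 : x ∈ X <;> by_cases h2 : x ∈ Y <;> simp [projE_apply, h1, h2]
    rw [List.map_cons, List.prod_cons, List.map_cons, List.prod_cons,
      mul_apply_eq_comp, h, ih, mul_assoc]

/-! ### The action of `P` on its nonempty subsets. -/

variable (P : Type u)

/-- The set of nonempty subsets of `P`. -/
abbrev NonemptySets : Type u := {Y : Set P // Y.Nonempty}

variable {P}

/-- The nonempty subsets of `X`. -/
def nonemptySubsets (X : Set P) : Set (NonemptySets P) := {Y | (Y : Set P) ⊆ X}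

variable [Monoid P]

/-- Left translation of nonempty subsets. -/
def translate (p : P) (Y : NonemptySets P) : NonemptySets P :=
  ⟨(fun x => p * x) '' Y, Y.2.image _⟩

/-- Every nonempty subset of `pX` is `pZ` for some nonempty `Z ⊆ X`. This is the combinatorial
content of the relation `v_p e_X v_p^* = e_{pX}`. -/
theorem translate_image_nonemptySubsets (p : P) (X : Set P) :
    translate p '' nonemptySubsets X = nonemptySubsets ((fun x => p * x) '' X) := by
  ext Y
  constructor
  · rintro ⟨Z, hZ, rfl⟩
    exact Set.image_mono hZ
  · intro hY
    obtain ⟨Z, hZ, hZY⟩ := Set.subset_image_iff.1 (show (Y : Set P) ⊆ _ from hY)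
    have hne : Z.Nonempty := Set.image_nonempty.1 (hZY ▸ Y.2)
    exact ⟨⟨Z, hne⟩, hZ, Subtype.ext hZY⟩

variable [IsLeftCancelMul P]

theorem translate_injective (p : P) : (translate p).Injective := fun _ _ h =>
  Subtype.ext ((mul_right_injective p).image_injective (congrArg Subtype.val h))

/-- The translations of nonempty subsets and the projections onto the subsets of `X` represent the
relations of `C*(P)`. -/
theorem translate_satisfiesRelations (𝒥 : Set (Set P)) :
    SatisfiesRelations 𝒥 (fun p => extendV (translate_injective p))
      (fun X => projE (nonemptySubsets (X : Set P))) where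
  isometry p := extendV_star_mul_self _
  projection X := projE_isStarProjection _
  v_mul p q := extendV_comp _ _ _ fun Y => Subtype.ext <| by
    simp [translate, Set.image_image, mul_assoc]
  conj p X Y hY := by
    rw [extendV_conj_projE, translate_image_nonemptySubsets, hY]
  e_univ X hX := by
    ext f y
    simp [projE_apply, hX, nonemptySubsets]
  e_empty X hX := by
    ext f y
    -- Here the exclusion of the empty subset is essential: it would survive in `e ∅`.
    have : y ∉ nonemptySubsets (∅ : Set P) := fun h => y.2.ne_empty (Set.subset_empty_iff.1 h)
    simp [projE_apply, hX, this]
  e_inter X Y Z hZ := by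
    ext f y
    have : y ∈ nonemptySubsets (Z : Set P) ↔
        y ∈ nonemptySubsets (X : Set P) ∧ y ∈ nonemptySubsets (Y : Set P) := by
      rw [hZ]
      exact Set.subset_inter_iff
    by_cases h1 : y ∈ nonemptySubsets (X : Set P) <;>
      by_cases h2 : y ∈ nonemptySubsets (Y : Set P) <;>
      simp [projE_apply, this, h1, h2]

/-- If the left regular representation is injective on `D(P)`, then `𝒥` is independent. -/
theorem independent_of_injOn
    (hinj : ∀ d ∈ fullD P, regularRep P d = 0 → d = 0) : ConstructibleIdealsIndependent P := by
  intro n X Y hn hX hY hXY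
  by_contra! hne
  -- Nonemptiness makes `X` an index of a basis vector; if `X` were empty, the first `Y j` would be
  -- empty too and equal to `X`.
  have hXne : X.Nonempty := by
    rw [Set.nonempty_iff_ne_empty]
    rintro rfl
    exact hne ⟨0, hn⟩ (Set.subset_empty_iff.1 (hXY ▸ Set.subset_iUnion Y _)).symm
  let d : FullCStar P :=
    ((List.finRange n).map fun j => fullE ⟨X, hX⟩ - fullE ⟨Y j, hY j⟩).prod
  have hmem : ∀ Z, fullE Z ∈ fullD P := fun Z =>
    StarSubalgebra.le_topologicalClosure _ (StarAlgebra.subset_adjoin ℂ _ ⟨Z, rfl⟩)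
  have hd : d ∈ fullD P := by
    refine list_prod_mem fun a ha => ?_
    obtain ⟨j, -, rfl⟩ := List.mem_map.1 ha
    exact sub_mem (hmem _) (hmem _)
  -- At a point of `X` the factor of some `Y j` containing it vanishes; off `X` every factor does,
  -- and one exists because `1 ≤ n`.
  have hd0 : regularRep P d = 0 := by
    have h1 : regularRep P d = (((List.finRange n).map Y).map fun Z => projE X - projE Z).prod := by
      simp [d, map_list_prod, Function.comp_def]
    rw [h1]
    ext f x
    rw [list_prod_projE_sub_apply]
    refine mul_eq_zero_of_left (List.prod_eq_zero_iff.2 ?_) _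
    simp only [List.map_map, List.mem_map, List.mem_finRange, true_and, Function.comp_apply]
    by_cases hx : x ∈ X
    · obtain ⟨j, hj⟩ := Set.mem_iUnion.1 (hXY ▸ hx)
      exact ⟨j, by simp [hx, hj]⟩
    · have hx' : x ∉ Y ⟨0, hn⟩ := fun h => hx (hXY ▸ Set.mem_iUnion.2 ⟨_, h⟩)
      exact ⟨⟨0, hn⟩, by simp [hx, hx']⟩
  obtain ⟨φ, ⟨-, hφ⟩, -⟩ := full_universal _ _
    (translate_satisfiesRelations (constructibleIdeals P))
  have h1 : φ d = (((List.finRange n).map fun j => nonemptySubsets (Y j)).map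
      fun Z => projE (nonemptySubsets X) - projE Z).prod := by
    simp [d, map_list_prod, Function.comp_def, hφ]
  rw [hinj d hd hd0, map_zero] at h1
  -- At the index `X` each factor is `1 - 0`, since `X ⊆ Y j` would give `X = Y j`; yet `d = 0`
  -- would make the product 0.
  have h2 := list_prod_projE_sub_apply (nonemptySubsets X)
    ((List.finRange n).map fun j => nonemptySubsets (Y j)) (basisVec ⟨X, hXne⟩) ⟨X, hXne⟩
  rw [← h1, basisVec_apply_self, mul_one] at h2
  have h3 := List.prod_eq_zero_iff.1 h2.symm
  simp only [List.map_map, List.mem_map, List.mem_finRange, true_and, Function.comp_apply] at h3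
  obtain ⟨j, hj⟩ := h3
  have hXX : (⟨X, hXne⟩ : NonemptySets P) ∈ nonemptySubsets X := subset_refl X
  have hXYj : (⟨X, hXne⟩ : NonemptySets P) ∉ nonemptySubsets (Y j) := fun h =>
    hne j (Set.Subset.antisymm h (hXY ▸ Set.subset_iUnion Y j))
  simp [hXX, hXYj] at hj

end SubsetRep

end

end SemigroupCStar

theorem mainTheorem8 (P : Type u) [Monoid P] [IsLeftCancelMul P] :
    ((∀ a ∈ SemigroupCStar.unionD P, ∀ b ∈ SemigroupCStar.unionD P, a * b = b * a) ∧
      ∃ Φ : SemigroupCStar.unionD P ≃⋆ₐ[ℂ] SemigroupCStar.reducedD P,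
        ∀ d : SemigroupCStar.unionD P,
          (Φ d : SemigroupCStar.Ell2 P →L[ℂ] SemigroupCStar.Ell2 P) =
            SemigroupCStar.unionRegularRep P d) ∧
    (SemigroupCStar.ConstructibleIdealsIndependent P ↔
      ∃ Φ : SemigroupCStar.fullD P ≃⋆ₐ[ℂ] SemigroupCStar.reducedD P,
        ∀ d : SemigroupCStar.fullD P,
          (Φ d : SemigroupCStar.Ell2 P →L[ℂ] SemigroupCStar.Ell2 P) =
            SemigroupCStar.regularRep P d) := by
  open SemigroupCStar in
  refine ⟨⟨?_, ?_⟩, fun hind => ?_, ?_⟩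
  · exact union_satisfiesRelations.commute fun X hX Y hY => .inter hX hY
  · refine exists_starAlgEquiv_of_injOn (unionRegularRep P) ?_ ?_ ?_
    · rintro _ ⟨X, rfl⟩
      exact projE_mem_reducedD_of_union X.2
    · rintro _ ⟨X, hX, rfl⟩
      exact ⟨unionE ⟨X, IsConstructible.isUnionConstructible hX⟩,
        StarSubalgebra.le_topologicalClosure _ (StarAlgebra.subset_adjoin ℂ _ ⟨_, rfl⟩), rfl⟩
    · exact union_satisfiesRelations.eq_zero_of_map_eq_zero .univ
        (fun X hX Y hY => .inter hX hY) rfl union_satisfiesRelations.prime _ fun X => rfl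
  · refine exists_starAlgEquiv_of_injOn (regularRep P) ?_ ?_ ?_
    · rintro _ ⟨X, rfl⟩
      exact projE_mem_reducedD X.2
    · rintro _ ⟨X, hX, rfl⟩
      exact ⟨fullE ⟨X, hX⟩,
        StarSubalgebra.le_topologicalClosure _ (StarAlgebra.subset_adjoin ℂ _ ⟨_, rfl⟩), rfl⟩
    · exact full_satisfiesRelations.eq_zero_of_map_eq_zero .univ
        (fun X hX Y hY => .inter hX hY) rfl (full_satisfiesRelations.prime_of_independent hind) _
        fun X => rfl
  · rintro ⟨Φ, hΦ⟩
    refine independent_of_injOn fun d hd h0 => ?_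
    have h1 : Φ ⟨d, hd⟩ = 0 := Subtype.ext ((hΦ ⟨d, hd⟩).trans h0)
    exact congrArg Subtype.val ((map_eq_zero_iff Φ Φ.injective).1 h1)
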